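/- Let $\mathcal U_1,\mathcal U_2,\mathcal V$ be finite sets and let $P=P_{U_1,U_2,V}$ and $Q=Q_{U_1,U_2,V}$ be probability distributions on $\mathcal U_1\times\mathcal U_2\times\mathcal V$ with $P\ll Q$. Under hypothesis $H=0$ (resp. $H=1$) the triple $(U_1^n,U_2^n,V^n)$ is i.i.d. with single-letter law $P$ (resp. $Q$). Let $h_1,h_2$ be non-zero reals, $p,\sigma>0$, and consider the multiple-access channel $$Y_i=h_1x_{1,i}+h_2x_{2,i}+Z_i,\qquad i=1,\dots,n,$$ with real inputs, where the $Z_i$ are i.i.d., independent of $(U_1^n,U_2^n,V^n)$, with the generalized Gaussian density $$p_Z(z)=\frac{c_p}{\sigma}e^{-|z|^p/(2\sigma^p)},\qquad c_p=\frac{p}{2^{(p+1)/p}\,\Gamma(1/p)}$$ (for $p=2$ this is the Gaussian law with mean $0$ and variance $\sigma^2$). For $\ell\in\{1,2\}$ let $\Gamma_\ell(n)\ge 0$, $n\ge 1$, be cost budgets with $\Gamma_\ell(n)\to\infty$ and $\Gamma_\ell(n)/n\to 0$ as $n\to\infty$. A scheme of blocklength $n$ consists of encoders $f_\ell:\mathcal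 U_\ell^n\to\mathbb R^n$, $\ell\in\{1,2\}$, such that $\sum_{i=1}^n|x_i|^p\le\Gamma_\ell(n)$ for every $x^n=f_\ell(u_\ell^n)$, $u_\ell^n\in\mathcal U_\ell^n$, and of a measurable guessing function $g:\mathbb R^n\times\mathcal V^n\to\{0,1\}$. With inputs $x_\ell^n=f_\ell(U_\ell^n)$, its error probabilities are $\alpha_n=\mathbb P[g(Y^n,V^n)=1\mid H=0]$ and $\beta_n=\mathbb P[g(Y^n,V^n)=0\mid H=1]$. For $\epsilon\in[0,1)$, an exponent $\theta>0$ is called achievable if there is a sequence of schemes, one for each blocklength $n$, with $\limsup_{n\to\infty}\alpha_n\le\epsilon$ and $\liminf_{n\to\infty}-\frac1n\ln\beta_n\ge\theta$ (where $-\ln 0=+\infty$). Let $\theta^*$ be the supremum of all achievable exponents (with $\theta^*=0$ if there is none). Then, for every $p>0$, every $\epsilon\in[0,1)$ and all such budgets $\Gamma_1,\Gamma_2$, $$\theta^*=D(P_V\|Q_V),$$ where $P_V,Q_V$ are the marginals of $P,Q$ on $\mathcal V$ and $D$ is the Kullback–Leibler divergence (with natural logarithm). -/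

import Mathlib

open MeasureTheory ProbabilityTheory Filter Topology
open scoped ENNReal

noncomputable section

namespace SublinearMAC

/-! ### The general model: distributed testing over a memoryless MAC with input costs -/

section Model

variable {U₁ U₂ V X₁ X₂ Y : Type*} [MeasurableSpace U₁] [MeasurableSpace U₂] [MeasurableSpace V]
  [MeasurableSpace X₁] [MeasurableSpace X₂] [MeasurableSpace Y]

variable (U₁ U₂ V X₁ X₂ Y) in
/-- Encoding functions of the two sensors and guessing function of the decision center,
at blocklength `n`. -/
structure Scheme (n : ℕ) where
  f₁ : (Fin n → U₁) → (Fin n → X₁)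
  f₂ : (Fin n → U₂) → (Fin n → X₂)
  g : (Fin n → Y) × (Fin n → V) → Fin 2
  measurable_g : Measurable g

/-- The block-input cost constraints: every codeword `x^n` of sensor `ℓ` satisfies
`∑ i, c_ℓ (x i) ≤ b_ℓ`. -/
def Scheme.MeetsCost {n : ℕ} (S : Scheme U₁ U₂ V X₁ X₂ Y n)
    (c₁ : X₁ → ℝ) (c₂ : X₂ → ℝ) (b₁ b₂ : ℝ) : Prop :=
  (∀ u, ∑ i, c₁ (S.f₁ u i) ≤ b₁) ∧ (∀ u, ∑ i, c₂ (S.f₂ u i) ≤ b₂)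

/-- Law of the channel output block when the memoryless MAC `W` is fed with `x₁^n`, `x₂^n`. -/
def blockOutput (W : Kernel (X₁ × X₂) Y) {n : ℕ} (x₁ : Fin n → X₁) (x₂ : Fin n → X₂) :
    Measure (Fin n → Y) :=
  Measure.pi fun i => W (x₁ i, x₂ i)

/-- Joint law of `(Y^n, V^n)` when `(U₁^n, U₂^n, V^n)` is i.i.d. with single-letter law `R` and the
sensors send `x_ℓ^n = f_ℓ (u_ℓ^n)` over the memoryless MAC `W`. -/
def Scheme.law {n : ℕ} (S : Scheme U₁ U₂ V X₁ X₂ Y n) (R : Measure (U₁ × U₂ × V))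
    (W : Kernel (X₁ × X₂) Y) : Measure ((Fin n → Y) × (Fin n → V)) :=
  (Measure.pi fun _ : Fin n => R).bind fun u =>
    (blockOutput W (S.f₁ fun i => (u i).1) (S.f₂ fun i => (u i).2.1)).map
      fun y => (y, fun i => (u i).2.2)

/-- Type-I error probability `ℙ[g(Y^n, V^n) = 1 | H = 0]`. -/
def Scheme.typeI {n : ℕ} (S : Scheme U₁ U₂ V X₁ X₂ Y n) (P : Measure (U₁ × U₂ × V))
    (W : Kernel (X₁ × X₂) Y) : ℝ≥0∞ :=
  S.law P W {z | S.g z = 1}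

/-- Type-II error probability `ℙ[g(Y^n, V^n) = 0 | H = 1]`. -/
def Scheme.typeII {n : ℕ} (S : Scheme U₁ U₂ V X₁ X₂ Y n) (Q : Measure (U₁ × U₂ × V))
    (W : Kernel (X₁ × X₂) Y) : ℝ≥0∞ :=
  S.law Q W {z | S.g z = 0}

/-- `θ > 0` is an `(ε, Γ₁, Γ₂)`-achievable type-II error exponent. The logarithm takes values in
`[-∞, ∞]`, so that a vanishing type-II error probability has exponent `+∞`. -/
def IsAchievable (P Q : Measure (U₁ × U₂ × V)) (W : Kernel (X₁ × X₂) Y)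
    (c₁ : X₁ → ℝ) (c₂ : X₂ → ℝ) (Γ₁ Γ₂ : ℕ → ℝ) (ε θ : ℝ) : Prop :=
  0 < θ ∧ ∃ S : (n : ℕ) → Scheme U₁ U₂ V X₁ X₂ Y n,
    (∀ n, 1 ≤ n → (S n).MeetsCost c₁ c₂ (Γ₁ n) (Γ₂ n)) ∧
    limsup (fun n => (S n).typeI P W) atTop ≤ ENNReal.ofReal ε ∧
    (θ : EReal) ≤ liminf (fun n => -ENNReal.log ((S n).typeII Q W) / (n : EReal)) atTop

/-- The Stein exponent: supremum in `[0, ∞]` of all achievable type-II error exponents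
(`0` if there is none). -/
def steinExponent (P Q : Measure (U₁ × U₂ × V)) (W : Kernel (X₁ × X₂) Y)
    (c₁ : X₁ → ℝ) (c₂ : X₂ → ℝ) (Γ₁ Γ₂ : ℕ → ℝ) (ε : ℝ) : ℝ≥0∞ :=
  ⨆ (θ : ℝ) (_ : IsAchievable P Q W c₁ c₂ Γ₁ Γ₂ ε θ), ENNReal.ofReal θ

/-- The marginal law of `V`. -/
def marginalV (R : Measure (U₁ × U₂ × V)) : Measure V :=
  R.map fun u => u.2.2

end Model

/-- Stringent cost budgets: nonnegative, unbounded, and sublinear in the blocklength. -/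
structure IsStringentBudget (Γ : ℕ → ℝ) : Prop where
  nonneg : ∀ n, 1 ≤ n → 0 ≤ Γ n
  tendsto_atTop : Tendsto Γ atTop atTop
  sublinear : Tendsto (fun n : ℕ => Γ n / n) atTop (𝓝 0)

/-! ### The additive MAC with generalized Gaussian noise -/

/-- Density of the generalized Gaussian distribution with parameters `p, σ > 0`. -/
def genGaussianPDF (p σ z : ℝ) : ℝ :=
  p / ((2 : ℝ) ^ ((p + 1) / p) * Real.Gamma (1 / p)) / σ *
    Real.exp (-(|z| ^ p / (2 * σ ^ p)))

/-- The generalized Gaussian distribution with parameters `p, σ > 0`. -/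
def genGaussian (p σ : ℝ) : Measure ℝ :=
  volume.withDensity fun z => ENNReal.ofReal (genGaussianPDF p σ z)

/-- The MAC `Y = h₁ x₁ + h₂ x₂ + Z` with noise law `ν`, independent of the inputs. -/
def additiveMAC (h₁ h₂ : ℝ) (ν : Measure ℝ) [SFinite ν] : Kernel (ℝ × ℝ) ℝ where
  toFun x := ν.map fun z => h₁ * x.1 + h₂ * x.2 + z
  measurable' := by
    refine Measure.measurable_of_measurable_coe _ fun s hs => ?_
    have hm : Measurable fun q : (ℝ × ℝ) × ℝ => h₁ * q.1.1 + h₂ * q.1.2 + q.2 := by fun_prop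
    have h := measurable_measure_prodMk_left (ν := ν) (hm hs)
    convert h using 1
    funext x
    rw [Measure.map_apply (by fun_prop) hs]
    rfl

instance sFinite_genGaussian (p σ : ℝ) : SFinite (genGaussian p σ) := by
  unfold genGaussian; infer_instance

end SublinearMAC

end

namespace SublinearMAC

/-! ### Products of measures with densities -/

/-! Sublinear cost moves the output law too little to matter on the exponential scale, so the
receiver can do no better than test `P_V` against `Q_V` on its own side information. The density of
`Y^n` is proportional to `exp (-∑ |y i - a i| ^ p / (2 * σ ^ p))`, where `a` is the noiseless output
and `∑ |a i| ^ p = o(n)`. On a set where `∑ |y i| ^ p ≤ K * n`, replacing `a` by `0` changes the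
exponent by at most `n * δ` (`exists_abs_sub_rpow_sub_le`, `exists_blockOutput_compare`), and this
set carries almost all the mass once `K` is large (`exists_blockOutput_tail_le`). For the converse,
pass from the true inputs under `P` to zero inputs, where only the law of `V^n` differs between the
hypotheses. Then pay the likelihood ratio of `V^n`, typically at most `exp (n * (D + δ))`, and
restore the inputs under `Q` (`Scheme.law_le_mul_law`). A type-I error bounded away from one thus
forces a type-II error of at least a constant times `exp (-n * θ)` for each `θ > D`, which is a
strong converse. Achievability is the likelihood-ratio test on `V^n` with silent sensors. -/

lemma lintegral_fin_prod {E : Type*} [MeasurableSpace E] {n : ℕ} (μ : Fin n → Measure E)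
    [∀ i, SigmaFinite (μ i)] (f : Fin n → E → ℝ≥0∞) (hf : ∀ i, Measurable (f i)) :
    ∫⁻ x, ∏ i, f i (x i) ∂Measure.pi μ = ∏ i, ∫⁻ x, f i x ∂μ i := by
  induction n with
  | zero => simp
  | succ n ih =>
    have h := (measurePreserving_piFinSuccAbove μ 0).symm
    have hm : Measurable fun x : Fin n → E => ∏ i, f i.succ (x i) :=
      Finset.measurable_fun_prod _ fun i _ => (hf _).comp (measurable_pi_apply i)
    rw [← h.lintegral_comp (by fun_prop), Fin.prod_univ_succ, ← ih _ _ fun i => hf _,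
      ← lintegral_prod_mul (hf 0).aemeasurable hm.aemeasurable]
    refine lintegral_congr fun x => ?_
    simp [Fin.prod_univ_succ, MeasurableEquiv.piFinSuccAbove, Fin.insertNthEquiv]

lemma pi_withDensity {E : Type*} [MeasurableSpace E] {n : ℕ} (μ : Fin n → Measure E)
    [∀ i, SigmaFinite (μ i)] (f : Fin n → E → ℝ≥0∞) (hf : ∀ i, Measurable (f i))
    [∀ i, SigmaFinite ((μ i).withDensity (f i))] :
    Measure.pi (fun i => (μ i).withDensity (f i)) =
      (Measure.pi μ).withDensity fun x => ∏ i, f i (x i) := by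
  refine Measure.pi_eq fun s hs => ?_
  rw [withDensity_apply _ (MeasurableSet.univ_pi hs), Measure.restrict_pi_pi,
    lintegral_fin_prod _ _ hf]
  exact Finset.prod_congr rfl fun i _ => (withDensity_apply _ (hs i)).symm

/-! ### Perturbation of the `p`-th power cost -/

lemma abs_add_rpow_le {p : ℝ} (hp : 0 < p) (a b : ℝ) :
    |a + b| ^ p ≤ 2 ^ p * (|a| ^ p + |b| ^ p) := by
  have key : ∀ a b : ℝ, |a| ≤ |b| → |a + b| ^ p ≤ 2 ^ p * (|a| ^ p + |b| ^ p) := by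
    intro a b hab
    calc |a + b| ^ p ≤ (2 * |b|) ^ p := by
          gcongr
          linarith [abs_add_le a b]
      _ = 2 ^ p * |b| ^ p := Real.mul_rpow (by norm_num) (abs_nonneg _)
      _ ≤ _ := by
          gcongr
          linarith [Real.rpow_nonneg (abs_nonneg a) p]
  rcases le_total |a| |b| with h | h
  · exact key a b h
  · rw [add_comm a, add_comm (|a| ^ p)]
    exact key b a h

/-- Homogeneity reduces the claim to the ratio `a / y`. A small ratio is handled by continuity of
`|1 - t| ^ p` at `0`; otherwise `|y| ^ p` is itself a multiple of `|a| ^ p`. No convexity enters, so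
`p < 1` is covered. -/
lemma exists_abs_sub_rpow_sub_le {p η : ℝ} (hp : 0 < p) (hη : 0 < η) :
    ∃ C, 0 ≤ C ∧ ∀ y a : ℝ, |(|y - a| ^ p - |y| ^ p)| ≤ η * |y| ^ p + C * |a| ^ p := by
  have hc : ContinuousAt (fun t : ℝ => |1 - t| ^ p) 0 :=
    ContinuousAt.rpow_const (by fun_prop) (Or.inr hp.le)
  obtain ⟨r, hr, h⟩ := Metric.continuousAt_iff.1 hc η hη
  -- The first summand bounds `|y - a| ^ p` and the second bounds `|y| ^ p`, both in the regime `r *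
  -- |y| ≤ |a|`.
  refine ⟨2 ^ p * ((1 / r) ^ p + 1) + (1 / r) ^ p, by positivity, fun y a => ?_⟩
  have hy := Real.rpow_nonneg (abs_nonneg y) p
  have ha := Real.rpow_nonneg (abs_nonneg a) p
  rcases lt_or_ge |a| (r * |y|) with hlt | hge
  · have hy0 : 0 < |y| := by
      by_contra hn
      have : |y| = 0 := le_antisymm (not_lt.1 hn) (abs_nonneg _)
      rw [this, mul_zero] at hlt
      exact absurd (abs_nonneg a) (not_le.2 hlt)
    have hy1 : y ≠ 0 := abs_pos.1 hy0
    have ht : dist (a / y) 0 < r := by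
      rw [Real.dist_eq, sub_zero, abs_div, div_lt_iff₀ hy0]
      exact hlt
    have h2 := (h ht).le
    rw [Real.dist_eq] at h2
    simp only [sub_zero, abs_one, Real.one_rpow] at h2
    have he : |y - a| ^ p = |y| ^ p * |1 - a / y| ^ p := by
      rw [← Real.mul_rpow (abs_nonneg _) (abs_nonneg _), ← abs_mul, mul_sub, mul_one,
        mul_div_cancel₀ _ hy1]
    have : |y - a| ^ p - |y| ^ p = |y| ^ p * (|1 - a / y| ^ p - 1) := by rw [he]; ring
    rw [this, abs_mul, abs_of_nonneg hy, mul_comm η]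
    have := mul_le_mul_of_nonneg_left h2 hy
    have : 0 ≤ (2 ^ p * ((1 / r) ^ p + 1) + (1 / r) ^ p) * |a| ^ p := by positivity
    linarith
  · have h1 : |y| ^ p ≤ (1 / r) ^ p * |a| ^ p := by
      rw [← Real.mul_rpow (by positivity) (abs_nonneg _)]
      gcongr
      rw [one_div, inv_mul_eq_div, le_div_iff₀ hr, mul_comm]
      exact hge
    have h2 : |y - a| ^ p ≤ 2 ^ p * (|y| ^ p + |a| ^ p) := by
      simpa [sub_eq_add_neg] using abs_add_rpow_le hp y (-a)
    have h3 : (0 : ℝ) < 2 ^ p := by positivity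
    have h4 := mul_le_mul_of_nonneg_left h1 h3.le
    have h5 := Real.rpow_nonneg (abs_nonneg (y - a)) p
    have h6 := mul_nonneg hη.le hy
    rw [abs_le]
    constructor <;> nlinarith

/-! ### The generalized Gaussian law -/

lemma continuous_abs_rpow {p : ℝ} (hp : 0 < p) : Continuous fun z : ℝ => |z| ^ p :=
  continuous_abs.rpow_const fun _ => Or.inr hp.le

lemma continuous_genGaussianPDF {p : ℝ} (hp : 0 < p) (σ : ℝ) :
    Continuous (genGaussianPDF p σ) := by
  have := continuous_abs_rpow hp
  unfold genGaussianPDF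
  fun_prop

lemma genGaussianPDF_pos {p σ : ℝ} (hp : 0 < p) (hσ : 0 < σ) (z : ℝ) :
    0 < genGaussianPDF p σ z := by
  have := Real.Gamma_pos_of_pos (one_div_pos.2 hp)
  unfold genGaussianPDF
  positivity

lemma integrable_abs_rpow_mul_exp {p q b : ℝ} (hp : 0 < p) (hq : -1 < q) (hb : 0 < b) :
    Integrable fun z : ℝ => |z| ^ q * Real.exp (-b * |z| ^ p) := by
  -- A non-integrable function has Bochner integral `0`, so the positive Gamma-function value of the
  -- integral yields integrability.
  refine Integrable.of_integral_ne_zero ?_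
  rw [integral_comp_abs (f := fun z : ℝ => z ^ q * Real.exp (-b * z ^ p)),
    integral_rpow_mul_exp_neg_mul_rpow hp hq hb]
  have : 0 < Real.Gamma ((q + 1) / p) := Real.Gamma_pos_of_pos (div_pos (by linarith) hp)
  positivity

lemma integrable_genGaussianPDF {p σ : ℝ} (hp : 0 < p) (hσ : 0 < σ) :
    Integrable (genGaussianPDF p σ) := by
  have h := (integrable_abs_rpow_mul_exp hp (q := 0) (by norm_num)
    (b := 1 / (2 * σ ^ p)) (by positivity)).const_mul
      (p / ((2 : ℝ) ^ ((p + 1) / p) * Real.Gamma (1 / p)) / σ)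
  refine h.congr (ae_of_all _ fun z => ?_)
  simp only [genGaussianPDF, Real.rpow_zero, one_mul]
  congr 2
  ring

lemma integral_genGaussianPDF {p σ : ℝ} (hp : 0 < p) (hσ : 0 < σ) :
    ∫ z, genGaussianPDF p σ z = 1 := by
  have hG := Real.Gamma_pos_of_pos (one_div_pos.2 hp)
  have h := integral_exp_neg_mul_rpow hp (b := 1 / (2 * σ ^ p)) (by positivity)
  have h2 := integral_comp_abs (f := fun z : ℝ => Real.exp (-(1 / (2 * σ ^ p)) * z ^ p))
  rw [h] at h2
  have h3 : ∀ z, genGaussianPDF p σ z = p / ((2 : ℝ) ^ ((p + 1) / p) * Real.Gamma (1 / p)) / σ *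
      Real.exp (-(1 / (2 * σ ^ p)) * |z| ^ p) := fun z => by
    unfold genGaussianPDF
    congr 2
    ring
  simp_rw [h3]
  rw [integral_const_mul, h2, Real.Gamma_add_one (one_div_pos.2 hp).ne']
  have e1 : (1 / (2 * σ ^ p)) ^ (-1 / p) = 2 ^ (1 / p) * σ := by
    rw [one_div, Real.inv_rpow (by positivity), ← Real.rpow_neg (by positivity),
      Real.mul_rpow (by norm_num) (by positivity), ← Real.rpow_mul hσ.le]
    rw [show -(-1 / p) = 1 / p by ring, mul_one_div_cancel hp.ne', Real.rpow_one]
  have e2 : (2 : ℝ) ^ ((p + 1) / p) = 2 * 2 ^ (1 / p) := by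
    rw [add_div, div_self hp.ne', Real.rpow_add (by norm_num), Real.rpow_one]
  rw [e1, e2]
  have : (0 : ℝ) < 2 ^ (1 / p) := by positivity
  field_simp

lemma isProbabilityMeasure_genGaussian {p σ : ℝ} (hp : 0 < p) (hσ : 0 < σ) :
    IsProbabilityMeasure (genGaussian p σ) := by
  refine ⟨?_⟩
  rw [genGaussian, withDensity_apply _ MeasurableSet.univ, Measure.restrict_univ,
    ← ofReal_integral_eq_lintegral_ofReal (integrable_genGaussianPDF hp hσ)
      (ae_of_all _ fun z => (genGaussianPDF_pos hp hσ z).le), integral_genGaussianPDF hp hσ,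
    ENNReal.ofReal_one]

lemma lintegral_abs_rpow_genGaussian_lt_top {p σ : ℝ} (hp : 0 < p) (hσ : 0 < σ) :
    ∫⁻ z, ENNReal.ofReal (|z| ^ p) ∂genGaussian p σ < ∞ := by
  have hm := (continuous_genGaussianPDF hp σ).measurable
  have hm' := (continuous_abs_rpow hp).measurable
  rw [genGaussian, lintegral_withDensity_eq_lintegral_mul _ hm.ennreal_ofReal hm'.ennreal_ofReal]
  have h := (integrable_abs_rpow_mul_exp hp (q := p) (by linarith)
    (b := 1 / (2 * σ ^ p)) (by positivity)).const_mul
      (p / ((2 : ℝ) ^ ((p + 1) / p) * Real.Gamma (1 / p)) / σ)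
  refine lt_of_le_of_lt (le_of_eq ?_) h.lintegral_lt_top
  refine lintegral_congr fun z => ?_
  rw [Pi.mul_apply, ← ENNReal.ofReal_mul (genGaussianPDF_pos hp hσ z).le]
  congr 1
  unfold genGaussianPDF
  rw [show -(|z| ^ p / (2 * σ ^ p)) = -(1 / (2 * σ ^ p)) * |z| ^ p by ring]
  ring

lemma map_add_genGaussian {p : ℝ} (hp : 0 < p) (σ c : ℝ) :
    (genGaussian p σ).map (fun z => c + z) =
      volume.withDensity fun y => ENNReal.ofReal (genGaussianPDF p σ (y - c)) := by
  have hm := (continuous_genGaussianPDF hp σ).measurable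
  ext s hs
  rw [Measure.map_apply (by fun_prop) hs, genGaussian, withDensity_apply _ hs,
    withDensity_apply _ (measurable_const_add c hs),
    ← (measurePreserving_add_left volume c).setLIntegral_comp_preimage hs (by fun_prop)]
  simp

/-- Noiseless channel output. -/
noncomputable def noiselessOutput (h₁ h₂ : ℝ) {n : ℕ} (x₁ x₂ : Fin n → ℝ) (i : Fin n) : ℝ :=
  h₁ * x₁ i + h₂ * x₂ i

lemma isProbabilityMeasure_additiveMAC {p σ : ℝ} (hp : 0 < p) (hσ : 0 < σ) (h₁ h₂ : ℝ)
    (x : ℝ × ℝ) : IsProbabilityMeasure (additiveMAC h₁ h₂ (genGaussian p σ) x) := by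
  have := isProbabilityMeasure_genGaussian hp hσ
  change IsProbabilityMeasure ((genGaussian p σ).map fun z => h₁ * x.1 + h₂ * x.2 + z)
  exact Measure.isProbabilityMeasure_map (by fun_prop)

lemma isProbabilityMeasure_blockOutput {p σ : ℝ} (hp : 0 < p) (hσ : 0 < σ) (h₁ h₂ : ℝ) {n : ℕ}
    (x₁ x₂ : Fin n → ℝ) :
    IsProbabilityMeasure (blockOutput (additiveMAC h₁ h₂ (genGaussian p σ)) x₁ x₂) := by
  have := isProbabilityMeasure_additiveMAC hp hσ h₁ h₂
  unfold blockOutput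
  infer_instance

lemma blockOutput_additiveMAC {p σ : ℝ} (hp : 0 < p) (hσ : 0 < σ) (h₁ h₂ : ℝ) {n : ℕ}
    (x₁ x₂ : Fin n → ℝ) :
    blockOutput (additiveMAC h₁ h₂ (genGaussian p σ)) x₁ x₂ =
      (volume : Measure (Fin n → ℝ)).withDensity fun y =>
        ∏ i, ENNReal.ofReal (genGaussianPDF p σ (y i - noiselessOutput h₁ h₂ x₁ x₂ i)) := by
  have hm := (continuous_genGaussianPDF hp σ).measurable
  have hW : ∀ i, additiveMAC h₁ h₂ (genGaussian p σ) (x₁ i, x₂ i) = volume.withDensity fun y =>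
      ENNReal.ofReal (genGaussianPDF p σ (y - noiselessOutput h₁ h₂ x₁ x₂ i)) :=
    fun i => map_add_genGaussian hp σ _
  have hP := isProbabilityMeasure_additiveMAC hp hσ h₁ h₂
  have : ∀ i, IsProbabilityMeasure (volume.withDensity fun y =>
      ENNReal.ofReal (genGaussianPDF p σ (y - noiselessOutput h₁ h₂ x₁ x₂ i))) :=
    fun i => hW i ▸ hP _
  unfold blockOutput
  simp_rw [hW]
  rw [pi_withDensity _ _ fun i => by fun_prop]
  rfl

/-- The normalising constants cancel in the ratio of the two products, leaving only the difference
of the `p`-th power sums in the exponent. -/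
lemma prod_genGaussianPDF_le {p σ : ℝ} (hp : 0 < p) (hσ : 0 < σ) {n : ℕ} (y z : Fin n → ℝ) {B : ℝ}
    (h : ∑ i, |z i| ^ p ≤ ∑ i, |y i| ^ p + B) :
    ∏ i, ENNReal.ofReal (genGaussianPDF p σ (y i)) ≤
      ENNReal.ofReal (Real.exp (B / (2 * σ ^ p))) *
        ∏ i, ENNReal.ofReal (genGaussianPDF p σ (z i)) := by
  have hG := Real.Gamma_pos_of_pos (one_div_pos.2 hp)
  rw [← ENNReal.ofReal_prod_of_nonneg fun i _ => (genGaussianPDF_pos hp hσ _).le,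
    ← ENNReal.ofReal_prod_of_nonneg fun i _ => (genGaussianPDF_pos hp hσ _).le,
    ← ENNReal.ofReal_mul (Real.exp_nonneg _)]
  refine ENNReal.ofReal_le_ofReal ?_
  simp_rw [genGaussianPDF, Finset.prod_mul_distrib, ← Real.exp_sum]
  rw [mul_left_comm, ← Real.exp_add]
  refine mul_le_mul_of_nonneg_left (Real.exp_le_exp.2 ?_)
    (Finset.prod_nonneg fun i _ => by positivity)
  simp_rw [Finset.sum_neg_distrib, ← Finset.sum_div]
  have h2 : (∑ i, |z i| ^ p) / (2 * σ ^ p) ≤ (∑ i, |y i| ^ p + B) / (2 * σ ^ p) := by gcongr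
  rw [add_div] at h2
  linarith

/-! ### Concentration of the log-likelihood ratio -/

section AEP

variable {V : Type*} [Fintype V] [MeasurableSpace V] [MeasurableSingletonClass V]

/-- Chebyshev: the variance of the sum is `n * Var[f; μ]`, against a squared threshold `(n * δ) ^
2`. -/
lemma tendsto_measure_pi_abs_sum_sub_ge (μ : Measure V) [IsProbabilityMeasure μ] (f : V → ℝ)
    {δ : ℝ} (hδ : 0 < δ) :
    Tendsto (fun n : ℕ => Measure.pi (fun _ : Fin n => μ)
      {v | n * δ ≤ |∑ i, f (v i) - n * ∫ x, f x ∂μ|}) atTop (𝓝 0) := by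
  have hf : MemLp f 2 μ := MemLp.of_discrete
  have hlim : Tendsto (fun n : ℕ => ENNReal.ofReal (Var[f; μ] / δ ^ 2 / n)) atTop (𝓝 0) := by
    rw [← ENNReal.ofReal_zero]
    exact ENNReal.tendsto_ofReal (tendsto_const_div_atTop_nhds_zero_nat _)
  refine tendsto_of_tendsto_of_tendsto_of_le_of_le' tendsto_const_nhds hlim
    (Eventually.of_forall fun _ => zero_le) ?_
  filter_upwards [eventually_gt_atTop 0] with n hn
  have hn' : (0 : ℝ) < n := Nat.cast_pos.2 hn
  have hcomp : ∀ i : Fin n, MemLp (fun v : Fin n → V => f (v i)) 2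
      (Measure.pi fun _ : Fin n => μ) :=
    fun i => hf.comp_measurePreserving (measurePreserving_eval (fun _ : Fin n => μ) i)
  have hsum : MemLp (∑ i, fun v : Fin n → V => f (v i)) 2 (Measure.pi fun _ : Fin n => μ) :=
    memLp_finsetSum' _ fun i _ => hcomp i
  have hE : ∫ v, (∑ i, fun v : Fin n → V => f (v i)) v ∂(Measure.pi fun _ : Fin n => μ) =
      n * ∫ x, f x ∂μ := by
    simp_rw [Finset.sum_apply]
    rw [integral_finsetSum _ fun i _ => (hcomp i).integrable (by norm_num)]
    simp_rw [integral_comp_eval (μ := fun _ : Fin n => μ) hf.aestronglyMeasurable]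
    simp
  have h := meas_ge_le_variance_div_sq hsum (c := n * δ) (by positivity)
  rw [hE, variance_sum_pi (μ := fun _ : Fin n => μ) (X := fun _ => f) fun _ => hf] at h
  simp only [Finset.sum_apply, Finset.sum_const, Finset.card_univ, Fintype.card_fin,
    nsmul_eq_mul] at h
  refine h.trans (le_of_eq ?_)
  congr 1
  field_simp

/-- Atoms with `μ {x} = 0 < ν {x}` must be excluded: there `Real.log 0 = 0` makes `exp (llr μ ν x)`
equal to `1`. -/
lemma measure_singleton_eq_exp_llr_mul {μ ν : Measure V} [IsProbabilityMeasure μ]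
    [IsProbabilityMeasure ν] (hμν : μ ≪ ν) {x : V} (hx : μ {x} ≠ 0) :
    μ {x} = ENNReal.ofReal (Real.exp (llr μ ν x)) * ν {x} := by
  have hν : ν {x} ≠ 0 := fun h => hx (hμν h)
  have h1 : μ {x} = μ.rnDeriv ν x * ν {x} := by
    conv_lhs => rw [← Measure.withDensity_rnDeriv_eq μ ν hμν]
    rw [withDensity_apply _ (measurableSet_singleton x), lintegral_singleton]
  have h2 : μ.rnDeriv ν x ≠ 0 := fun h => hx (by rw [h1, h, zero_mul])
  have h3 : μ.rnDeriv ν x ≠ ∞ := fun h => by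
    rw [h, ENNReal.top_mul hν] at h1
    exact measure_ne_top μ _ h1
  rw [llr, Real.exp_log (ENNReal.toReal_pos h2 h3), ENNReal.ofReal_toReal h3, ← h1]

lemma pi_singleton_eq_exp_sum_llr_mul {μ ν : Measure V} [IsProbabilityMeasure μ]
    [IsProbabilityMeasure ν] (hμν : μ ≪ ν) {n : ℕ} {v : Fin n → V}
    (hv : Measure.pi (fun _ : Fin n => μ) {v} ≠ 0) :
    Measure.pi (fun _ : Fin n => μ) {v} =
      ENNReal.ofReal (Real.exp (∑ i, llr μ ν (v i))) * Measure.pi (fun _ : Fin n => ν) {v} := by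
  rw [Measure.pi_singleton] at hv ⊢
  rw [Measure.pi_singleton, Real.exp_sum,
    ENNReal.ofReal_prod_of_nonneg fun _ _ => Real.exp_nonneg _, ← Finset.prod_mul_distrib]
  exact Finset.prod_congr rfl fun i hi =>
    measure_singleton_eq_exp_llr_mul hμν (Finset.prod_ne_zero_iff.1 hv i hi)

lemma measure_setOf_singleton_eq_zero {α : Type*} [Countable α] [MeasurableSpace α]
    (μ : Measure α) : μ {x | μ {x} = 0} = 0 := by
  rw [← Set.biUnion_of_singleton {x | μ {x} = 0}]
  exact (measure_biUnion_null_iff (Set.to_countable _)).2 fun x hx => hx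

lemma klDiv_eq_ofReal_integral_llr {μ ν : Measure V} [IsProbabilityMeasure μ]
    [IsProbabilityMeasure ν] (hμν : μ ≪ ν) :
    InformationTheory.klDiv μ ν = ENNReal.ofReal (∫ x, llr μ ν x ∂μ) := by
  rw [← InformationTheory.toReal_klDiv_of_measure_eq hμν (by simp), ENNReal.ofReal_toReal
    (InformationTheory.klDiv_ne_top hμν Integrable.of_finite)]

/-- Under `μ ^ n`, the likelihood ratio `μ ^ n / ν ^ n` is asymptotically at most `exp (n θ)`
for every `θ` above the divergence. -/
lemma tendsto_measure_not_le_of_lt {μ ν : Measure V} [IsProbabilityMeasure μ]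
    [IsProbabilityMeasure ν] (hμν : μ ≪ ν) {θ : ℝ} (hθ : ∫ x, llr μ ν x ∂μ < θ) :
    Tendsto (fun n : ℕ => Measure.pi (fun _ : Fin n => μ)
      {v | ¬ Measure.pi (fun _ : Fin n => μ) {v} ≤
        ENNReal.ofReal (Real.exp (n * θ)) * Measure.pi (fun _ : Fin n => ν) {v}}) atTop (𝓝 0) := by
  refine tendsto_of_tendsto_of_tendsto_of_le_of_le tendsto_const_nhds
    (tendsto_measure_pi_abs_sum_sub_ge μ (llr μ ν) (sub_pos.2 hθ)) (fun _ => zero_le)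
    fun n => measure_mono fun v hv => ?_
  simp only [Set.mem_ofPred_eq] at hv ⊢
  by_contra hc
  rw [not_le, mul_sub] at hc
  refine hv ?_
  -- Where `μ ^ n` vanishes the log-likelihood formula fails, but the upper bound is trivial.
  by_cases h0 : Measure.pi (fun _ : Fin n => μ) {v} = 0
  · rw [h0]; exact zero_le
  · rw [pi_singleton_eq_exp_sum_llr_mul hμν h0]
    gcongr
    linarith [(abs_lt.1 hc).2]

/-- Under `μ ^ n`, the likelihood ratio `μ ^ n / ν ^ n` is asymptotically at least `exp (n θ)`
for every `θ` below the divergence. -/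
lemma tendsto_measure_not_le_of_gt {μ ν : Measure V} [IsProbabilityMeasure μ]
    [IsProbabilityMeasure ν] (hμν : μ ≪ ν) {θ : ℝ} (hθ : θ < ∫ x, llr μ ν x ∂μ) :
    Tendsto (fun n : ℕ => Measure.pi (fun _ : Fin n => μ)
      {v | ¬ ENNReal.ofReal (Real.exp (n * θ)) * Measure.pi (fun _ : Fin n => ν) {v} ≤
        Measure.pi (fun _ : Fin n => μ) {v}}) atTop (𝓝 0) := by
  refine tendsto_of_tendsto_of_tendsto_of_le_of_le tendsto_const_nhds
    (tendsto_measure_pi_abs_sum_sub_ge μ (llr μ ν) (sub_pos.2 hθ)) (fun _ => zero_le)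
    fun n => ?_
  -- Points of zero `μ ^ n`-mass may violate the lower bound, so they are added to the bad event as
  -- a null set.
  rw [← add_zero (Measure.pi (fun _ : Fin n => μ) {v | _ ≤ |_|}),
    ← measure_setOf_singleton_eq_zero (Measure.pi fun _ : Fin n => μ)]
  refine (measure_mono fun v hv => ?_).trans (measure_union_le _ _)
  simp only [Set.mem_union, Set.mem_ofPred_eq] at hv ⊢
  by_contra! hc
  obtain ⟨hc, h0⟩ := hc
  rw [mul_sub] at hc
  refine hv ?_
  rw [pi_singleton_eq_exp_sum_llr_mul hμν h0]
  gcongr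
  linarith [(abs_lt.1 hc).1]

end AEP

/-! ### Perturbation of the channel output by inputs of small cost -/

/-- The densities for inputs `x₁, x₂` and for zero inputs are compared pointwise. Confining `s` to
outputs of energy at most `K * n` keeps the term `η * ∑ |y i| ^ p` linear in `n` with a small slope.
-/
lemma exists_blockOutput_compare {p σ K δ : ℝ} (hp : 0 < p) (hσ : 0 < σ) (hK : 0 < K) (hδ : 0 < δ)
    (h₁ h₂ : ℝ) :
    ∃ κ, 0 < κ ∧ ∀ (n : ℕ) (x₁ x₂ : Fin n → ℝ),
      ∑ i, |noiselessOutput h₁ h₂ x₁ x₂ i| ^ p ≤ κ * n →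
      ∀ s ⊆ {y : Fin n → ℝ | ∑ i, |y i| ^ p ≤ K * n}, MeasurableSet s →
        blockOutput (additiveMAC h₁ h₂ (genGaussian p σ)) x₁ x₂ s ≤
          ENNReal.ofReal (Real.exp (n * δ)) *
            blockOutput (additiveMAC h₁ h₂ (genGaussian p σ)) 0 0 s ∧
        blockOutput (additiveMAC h₁ h₂ (genGaussian p σ)) 0 0 s ≤
          ENNReal.ofReal (Real.exp (n * δ)) *
            blockOutput (additiveMAC h₁ h₂ (genGaussian p σ)) x₁ x₂ s := by
  have hσp : 0 < σ ^ p := Real.rpow_pos_of_pos hσ p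
  -- With this `η` and the `κ` below, the output energy and the input energy each contribute at most
  -- `n * δ * σ ^ p`; dividing the total by `2 * σ ^ p` gives `n * δ`. The denominator `C + 1`
  -- allows for `C = 0`.
  obtain ⟨C, hC, h⟩ := exists_abs_sub_rpow_sub_le hp (η := δ * σ ^ p / K) (by positivity)
  refine ⟨δ * σ ^ p / (C + 1), by positivity, fun n x₁ x₂ hx s hs hsm => ?_⟩
  have hn : (0 : ℝ) ≤ n := Nat.cast_nonneg n
  have hm := (continuous_genGaussianPDF hp σ).measurable
  have hB : ∀ y ∈ s, |∑ i, |y i - noiselessOutput h₁ h₂ x₁ x₂ i| ^ p - ∑ i, |y i| ^ p| ≤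
      n * δ * (2 * σ ^ p) := by
    intro y hy
    have hy' : ∑ i, |y i| ^ p ≤ K * n := hs hy
    rw [← Finset.sum_sub_distrib]
    refine (Finset.abs_sum_le_sum_abs _ _).trans ((Finset.sum_le_sum fun i _ => h _ _).trans ?_)
    rw [Finset.sum_add_distrib, ← Finset.mul_sum, ← Finset.mul_sum]
    have e1 : δ * σ ^ p / K * ∑ i, |y i| ^ p ≤ n * δ * σ ^ p := by
      calc _ ≤ δ * σ ^ p / K * (K * n) := by gcongr
        _ = _ := by field_simp
    have e2 : C * ∑ i, |noiselessOutput h₁ h₂ x₁ x₂ i| ^ p ≤ n * δ * σ ^ p := by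
      calc _ ≤ C * (δ * σ ^ p / (C + 1) * n) := by gcongr
        _ = C / (C + 1) * (n * δ * σ ^ p) := by ring
        _ ≤ 1 * (n * δ * σ ^ p) := by
          gcongr
          rw [div_le_one (by linarith)]
          linarith
        _ = _ := one_mul _
    linarith
  have hexp : n * δ * (2 * σ ^ p) / (2 * σ ^ p) = n * δ := by field_simp
  have h0 : noiselessOutput h₁ h₂ (0 : Fin n → ℝ) 0 = 0 := by
    funext i
    simp [noiselessOutput]
  rw [blockOutput_additiveMAC hp hσ, blockOutput_additiveMAC hp hσ, withDensity_apply _ hsm,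
    withDensity_apply _ hsm, h0, ← lintegral_const_mul' _ _ ENNReal.ofReal_ne_top,
    ← lintegral_const_mul' _ _ ENNReal.ofReal_ne_top]
  simp only [Pi.zero_apply, sub_zero]
  constructor
  · refine setLIntegral_mono' hsm fun y hy => ?_
    have := prod_genGaussianPDF_le hp hσ (fun i => y i - noiselessOutput h₁ h₂ x₁ x₂ i) y
      (B := n * δ * (2 * σ ^ p)) (by linarith [(abs_le.1 (hB y hy)).1])
    rwa [hexp] at this
  · refine setLIntegral_mono' hsm fun y hy => ?_
    have := prod_genGaussianPDF_le hp hσ y (fun i => y i - noiselessOutput h₁ h₂ x₁ x₂ i)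
      (B := n * δ * (2 * σ ^ p)) (by linarith [(abs_le.1 (hB y hy)).2])
    rwa [hexp] at this

/-- Markov's inequality for `∑ |y i| ^ p`, whose mean is at most `2 ^ p * (1 + M) * n` with `M` the
`p`-th absolute moment of the noise. The constant does not depend on `n`, the inputs or `K`. -/
lemma exists_blockOutput_tail_le {p σ : ℝ} (hp : 0 < p) (hσ : 0 < σ) (h₁ h₂ : ℝ) :
    ∃ C, 0 < C ∧ ∀ (n : ℕ) (x₁ x₂ : Fin n → ℝ), 0 < n →
      ∑ i, |noiselessOutput h₁ h₂ x₁ x₂ i| ^ p ≤ n → ∀ K, 0 < K →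
        blockOutput (additiveMAC h₁ h₂ (genGaussian p σ)) x₁ x₂ {y | K * n < ∑ i, |y i| ^ p} ≤
          ENNReal.ofReal (C / K) := by
  have hprob := isProbabilityMeasure_genGaussian hp hσ
  have hMAC := isProbabilityMeasure_additiveMAC hp hσ h₁ h₂
  have hc := (continuous_abs_rpow hp).measurable
  set M := (∫⁻ z, ENNReal.ofReal (|z| ^ p) ∂genGaussian p σ).toReal with hM
  have hM' : ∫⁻ z, ENNReal.ofReal (|z| ^ p) ∂genGaussian p σ = ENNReal.ofReal M :=
    (ENNReal.ofReal_toReal (lintegral_abs_rpow_genGaussian_lt_top hp hσ).ne).symm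
  have hM0 : 0 ≤ M := ENNReal.toReal_nonneg
  refine ⟨2 ^ p * (1 + M), by positivity, fun n x₁ x₂ hn hx K hK => ?_⟩
  have hn' : (0 : ℝ) < n := Nat.cast_pos.2 hn
  have hnn : ∀ t : ℝ, 0 ≤ |t| ^ p := fun t => Real.rpow_nonneg (abs_nonneg t) p
  set a := noiselessOutput h₁ h₂ x₁ x₂ with ha
  have hci : ∀ i, Measurable fun y : Fin n → ℝ => ENNReal.ofReal (|y i| ^ p) :=
    fun i => (hc.comp (measurable_pi_apply i)).ennreal_ofReal
  have hone : ∀ i, ∫⁻ y, ENNReal.ofReal (|y i| ^ p)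
      ∂blockOutput (additiveMAC h₁ h₂ (genGaussian p σ)) x₁ x₂ ≤
        ENNReal.ofReal (2 ^ p * (|a i| ^ p + M)) := by
    intro i
    have := (measurePreserving_eval
      (fun i => additiveMAC h₁ h₂ (genGaussian p σ) (x₁ i, x₂ i)) i).lintegral_comp
        hc.ennreal_ofReal
    rw [blockOutput]
    refine this.trans_le ?_
    change ∫⁻ y, ENNReal.ofReal (|y| ^ p) ∂(genGaussian p σ).map (fun z => a i + z) ≤ _
    rw [lintegral_map hc.ennreal_ofReal (by fun_prop)]
    calc ∫⁻ z, ENNReal.ofReal (|a i + z| ^ p) ∂genGaussian p σ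
        ≤ ∫⁻ z, ENNReal.ofReal (2 ^ p) * (ENNReal.ofReal (|a i| ^ p) + ENNReal.ofReal (|z| ^ p))
            ∂genGaussian p σ := by
          refine lintegral_mono fun z => ?_
          rw [← ENNReal.ofReal_add (hnn _) (hnn _), ← ENNReal.ofReal_mul (by positivity)]
          exact ENNReal.ofReal_le_ofReal (abs_add_rpow_le hp _ _)
      _ = ENNReal.ofReal (2 ^ p * (|a i| ^ p + M)) := by
          rw [lintegral_const_mul' _ _ ENNReal.ofReal_ne_top, lintegral_add_left measurable_const,
            lintegral_const, measure_univ, mul_one, hM', ← ENNReal.ofReal_add (hnn _) hM0,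
            ← ENNReal.ofReal_mul (by positivity)]
  have hsum : ∫⁻ y, ∑ i, ENNReal.ofReal (|y i| ^ p)
      ∂blockOutput (additiveMAC h₁ h₂ (genGaussian p σ)) x₁ x₂ ≤
        ENNReal.ofReal (2 ^ p * (1 + M) * n) := by
    rw [lintegral_finsetSum _ fun i _ => hci i]
    refine (Finset.sum_le_sum fun i _ => hone i).trans ?_
    rw [← ENNReal.ofReal_sum_of_nonneg fun i _ => by have := hnn (a i); positivity]
    refine ENNReal.ofReal_le_ofReal ?_
    rw [← Finset.mul_sum, Finset.sum_add_distrib, Finset.sum_const, Finset.card_univ,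
      Fintype.card_fin, nsmul_eq_mul, mul_assoc]
    gcongr
    linarith
  have hmarkov := meas_ge_le_lintegral_div
    (μ := blockOutput (additiveMAC h₁ h₂ (genGaussian p σ)) x₁ x₂)
    (f := fun y : Fin n → ℝ => ∑ i, ENNReal.ofReal (|y i| ^ p))
    (Finset.measurable_fun_sum _ fun i _ => hci i).aemeasurable
    (ε := ENNReal.ofReal (K * n)) (by simp only [ne_eq, ENNReal.ofReal_eq_zero, not_le]; positivity)
    ENNReal.ofReal_ne_top
  refine (measure_mono fun y hy => ?_).trans (hmarkov.trans ?_)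
  · simp only [Set.mem_ofPred_eq] at hy ⊢
    rw [← ENNReal.ofReal_sum_of_nonneg fun i _ => hnn _]
    exact ENNReal.ofReal_le_ofReal hy.le
  · refine (ENNReal.div_le_div_right hsum _).trans_eq ?_
    rw [← ENNReal.ofReal_div_of_pos (by positivity)]
    congr 1
    field_simp

lemma eventually_noiselessOutput_cost_le {p κ : ℝ} (hp : 0 < p) (hκ : 0 < κ) (h₁ h₂ : ℝ)
    {Γ₁ Γ₂ : ℕ → ℝ} (hΓ₁ : Tendsto (fun n : ℕ => Γ₁ n / n) atTop (𝓝 0))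
    (hΓ₂ : Tendsto (fun n : ℕ => Γ₂ n / n) atTop (𝓝 0)) :
    ∀ᶠ n : ℕ in atTop, ∀ x₁ x₂ : Fin n → ℝ, ∑ i, |x₁ i| ^ p ≤ Γ₁ n → ∑ i, |x₂ i| ^ p ≤ Γ₂ n →
      ∑ i, |noiselessOutput h₁ h₂ x₁ x₂ i| ^ p ≤ κ * n := by
  have hlim : Tendsto (fun n : ℕ => 2 ^ p * (|h₁| ^ p * (Γ₁ n / n) + |h₂| ^ p * (Γ₂ n / n)))
      atTop (𝓝 0) := by
    simpa using ((hΓ₁.const_mul (|h₁| ^ p)).add (hΓ₂.const_mul (|h₂| ^ p))).const_mul (2 ^ p)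
  filter_upwards [hlim.eventually (gt_mem_nhds hκ), eventually_gt_atTop 0]
    with n hn hn0 x₁ x₂ hx₁ hx₂
  have hn' : (0 : ℝ) < n := Nat.cast_pos.2 hn0
  calc ∑ i, |noiselessOutput h₁ h₂ x₁ x₂ i| ^ p
      ≤ ∑ i, 2 ^ p * (|h₁| ^ p * |x₁ i| ^ p + |h₂| ^ p * |x₂ i| ^ p) := by
        refine Finset.sum_le_sum fun i _ => ?_
        rw [← Real.mul_rpow (abs_nonneg _) (abs_nonneg _), ← abs_mul,
          ← Real.mul_rpow (abs_nonneg _) (abs_nonneg _), ← abs_mul]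
        exact abs_add_rpow_le hp _ _
    _ = 2 ^ p * (|h₁| ^ p * ∑ i, |x₁ i| ^ p + |h₂| ^ p * ∑ i, |x₂ i| ^ p) := by
        rw [← Finset.mul_sum, Finset.sum_add_distrib, ← Finset.mul_sum, ← Finset.mul_sum]
    _ ≤ 2 ^ p * (|h₁| ^ p * Γ₁ n + |h₂| ^ p * Γ₂ n) := by
        have := Real.rpow_nonneg (abs_nonneg h₁) p
        have := Real.rpow_nonneg (abs_nonneg h₂) p
        gcongr
    _ = 2 ^ p * (|h₁| ^ p * (Γ₁ n / n) + |h₂| ^ p * (Γ₂ n / n)) * n := by field_simp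
    _ ≤ κ * n := by gcongr

/-! ### The law of the observations at the decision center -/

lemma isProbabilityMeasure_marginalV {U₁ U₂ V : Type*} [MeasurableSpace U₁] [MeasurableSpace U₂]
    [MeasurableSpace V] (R : Measure (U₁ × U₂ × V)) [IsProbabilityMeasure R] :
    IsProbabilityMeasure (marginalV R) :=
  Measure.isProbabilityMeasure_map (by fun_prop)

/-- This removes the sensors: once the inputs are replaced by zero, the integrand sees the source
block only through `V^n`. -/
lemma lintegral_pi_comp_snd_snd {U₁ U₂ V : Type*} [MeasurableSpace U₁] [MeasurableSpace U₂]
    [Finite V] [MeasurableSpace V] [MeasurableSingletonClass V]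
    (R : Measure (U₁ × U₂ × V)) [IsProbabilityMeasure R] {n : ℕ}
    (F : (Fin n → V) → ℝ≥0∞) :
    ∫⁻ u, F (fun i => (u i).2.2) ∂(Measure.pi fun _ : Fin n => R) =
      ∫⁻ v, F v ∂(Measure.pi fun _ : Fin n => marginalV R) := by
  have := isProbabilityMeasure_marginalV R
  have h : Measure.pi (fun _ : Fin n => marginalV R) =
      (Measure.pi fun _ : Fin n => R).map fun u i => (u i).2.2 := by
    unfold marginalV at this ⊢
    exact (Measure.pi_map_pi (μ := fun _ : Fin n => R) (f := fun _ u => u.2.2)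
      fun _ => by fun_prop).symm
  rw [h, lintegral_map (measurable_of_countable _) (by fun_prop)]

section Law

variable {U₁ U₂ V : Type*}
  [Fintype U₁] [MeasurableSpace U₁] [MeasurableSingletonClass U₁]
  [Fintype U₂] [MeasurableSpace U₂] [MeasurableSingletonClass U₂]
  [Fintype V] [MeasurableSpace V] [MeasurableSingletonClass V]

lemma Scheme.law_apply {X₁ X₂ Y : Type*} [MeasurableSpace X₁] [MeasurableSpace X₂]
    [MeasurableSpace Y] {n : ℕ} (S : Scheme U₁ U₂ V X₁ X₂ Y n) (R : Measure (U₁ × U₂ × V))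
    (W : Kernel (X₁ × X₂) Y) {s : Set ((Fin n → Y) × (Fin n → V))} (hs : MeasurableSet s) :
    S.law R W s = ∫⁻ u, blockOutput W (S.f₁ fun i => (u i).1) (S.f₂ fun i => (u i).2.1)
      {y | (y, fun i => (u i).2.2) ∈ s} ∂Measure.pi fun _ : Fin n => R := by
  rw [Scheme.law, Measure.bind_apply hs (measurable_of_countable _).aemeasurable]
  refine lintegral_congr fun u => ?_
  rw [Measure.map_apply (by fun_prop) hs]
  rfl

variable {p σ h₁ h₂ : ℝ}

lemma Scheme.law_univ (hp : 0 < p) (hσ : 0 < σ) {n : ℕ} (S : Scheme U₁ U₂ V ℝ ℝ ℝ n)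
    (R : Measure (U₁ × U₂ × V)) [IsProbabilityMeasure R] :
    S.law R (additiveMAC h₁ h₂ (genGaussian p σ)) Set.univ = 1 := by
  have := fun x₁ x₂ => isProbabilityMeasure_blockOutput hp hσ h₁ h₂ (n := n) x₁ x₂
  rw [S.law_apply _ _ MeasurableSet.univ]
  simp

lemma Scheme.law_setOf_snd_mem (hp : 0 < p) (hσ : 0 < σ) {n : ℕ} (S : Scheme U₁ U₂ V ℝ ℝ ℝ n)
    (R : Measure (U₁ × U₂ × V)) [IsProbabilityMeasure R] (T : Set (Fin n → V)) :
    S.law R (additiveMAC h₁ h₂ (genGaussian p σ)) {z | z.2 ∈ T} =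
      Measure.pi (fun _ : Fin n => marginalV R) T := by
  have := fun x₁ x₂ => isProbabilityMeasure_blockOutput hp hσ h₁ h₂ (n := n) x₁ x₂
  have hT : MeasurableSet T := T.toFinite.measurableSet
  rw [S.law_apply _ _ (s := {z | z.2 ∈ T}) (measurable_snd hT), ← lintegral_indicator_one hT,
    ← lintegral_pi_comp_snd_snd]
  refine lintegral_congr fun u => ?_
  by_cases h : (fun i => (u i).2.2) ∈ T <;> simp [h]

/-! ### Converse -/

/-- Change of measure: on an event where the inputs change the output law by a factor at most `b`
and the likelihood ratio of the side information is at most `L`, the law under `P` is at most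
`b * L * b` times the law under `Q`. -/
lemma Scheme.law_le_mul_law {n : ℕ} (S : Scheme U₁ U₂ V ℝ ℝ ℝ n)
    (P Q : Measure (U₁ × U₂ × V)) [IsProbabilityMeasure P] [IsProbabilityMeasure Q]
    (W : Kernel (ℝ × ℝ) ℝ) {b L : ℝ≥0∞} {s : Set ((Fin n → ℝ) × (Fin n → V))}
    (hb : b ≠ ∞) (hs : MeasurableSet s)
    (hle : ∀ u₁ u₂ v, blockOutput W (S.f₁ u₁) (S.f₂ u₂) {y | (y, v) ∈ s} ≤
      b * blockOutput W 0 0 {y | (y, v) ∈ s})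
    (hge : ∀ u₁ u₂ v, blockOutput W 0 0 {y | (y, v) ∈ s} ≤
      b * blockOutput W (S.f₁ u₁) (S.f₂ u₂) {y | (y, v) ∈ s})
    (hV : ∀ z ∈ s, Measure.pi (fun _ : Fin n => marginalV P) {z.2} ≤
      L * Measure.pi (fun _ : Fin n => marginalV Q) {z.2}) :
    S.law P W s ≤ b * L * b * S.law Q W s := by
  set F : (Fin n → V) → ℝ≥0∞ := fun v => blockOutput W 0 0 {y | (y, v) ∈ s} with hF
  have hPQ : ∫⁻ v, F v ∂(Measure.pi fun _ : Fin n => marginalV P) ≤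
      L * ∫⁻ v, F v ∂(Measure.pi fun _ : Fin n => marginalV Q) := by
    classical
    rw [lintegral_fintype, lintegral_fintype, Finset.mul_sum]
    refine Finset.sum_le_sum fun v _ => ?_
    -- The likelihood-ratio bound `hV` is available only at those `v` whose slice of `s` is
    -- nonempty.
    rcases Set.eq_empty_or_nonempty {y | (y, v) ∈ s} with h | ⟨y, hy⟩
    · simp [hF, h]
    · rw [mul_left_comm]
      gcongr
      exact hV _ hy
  calc S.law P W s
      ≤ b * ∫⁻ u, F (fun i => (u i).2.2) ∂(Measure.pi fun _ : Fin n => P) := by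
        rw [S.law_apply _ _ hs, ← lintegral_const_mul' _ _ hb]
        exact lintegral_mono fun u => hle _ _ _
    _ ≤ b * (L * ∫⁻ u, F (fun i => (u i).2.2) ∂(Measure.pi fun _ : Fin n => Q)) := by
        rw [lintegral_pi_comp_snd_snd, lintegral_pi_comp_snd_snd]
        gcongr
    _ ≤ b * (L * (b * S.law Q W s)) := by
        rw [S.law_apply Q _ hs, ← lintegral_const_mul' b _ hb]
        gcongr
        exact hge _ _ _
    _ = b * L * b * S.law Q W s := by ring

/-- The quantitative strong converse: acceptance, bounded output energy and typical side information
together keep `P`-probability at least `c`, and the change of measure carries this mass to `Q`. -/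
lemma exists_eventually_le_exp_mul_typeII
    (P Q : Measure (U₁ × U₂ × V)) [IsProbabilityMeasure P] [IsProbabilityMeasure Q] (hPQ : P ≪ Q)
    (hp : 0 < p) (hσ : 0 < σ) {ε : ℝ} (hε₀ : 0 ≤ ε) (hε₁ : ε < 1) {Γ₁ Γ₂ : ℕ → ℝ}
    (hΓ₁ : Tendsto (fun n : ℕ => Γ₁ n / n) atTop (𝓝 0))
    (hΓ₂ : Tendsto (fun n : ℕ => Γ₂ n / n) atTop (𝓝 0))
    (S : (n : ℕ) → Scheme U₁ U₂ V ℝ ℝ ℝ n)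
    (hS : ∀ n, 1 ≤ n → (S n).MeetsCost (fun x : ℝ => |x| ^ p) (fun x : ℝ => |x| ^ p) (Γ₁ n) (Γ₂ n))
    (hα : limsup (fun n => (S n).typeI P (additiveMAC h₁ h₂ (genGaussian p σ))) atTop ≤
      ENNReal.ofReal ε)
    {θ : ℝ} (hθ : ∫ v, llr (marginalV P) (marginalV Q) v ∂marginalV P < θ) :
    ∃ c, 0 < c ∧ ∀ᶠ n : ℕ in atTop, ENNReal.ofReal c ≤
      ENNReal.ofReal (Real.exp (n * θ)) *
        (S n).typeII Q (additiveMAC h₁ h₂ (genGaussian p σ)) := by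
  have := isProbabilityMeasure_marginalV P
  have := isProbabilityMeasure_marginalV Q
  have hV : marginalV P ≪ marginalV Q := hPQ.map (by fun_prop)
  set D := ∫ v, llr (marginalV P) (marginalV Q) v ∂marginalV P with hD
  set W := additiveMAC h₁ h₂ (genGaussian p σ) with hW
  -- One `δ` for each of the two changes of input and one for the likelihood ratio of `V^n`.
  set δ := (θ - D) / 3 with hδ
  have hδ0 : 0 < δ := by rw [hδ]; linarith
  -- Slack in the type-I error, large outputs and atypical side information each cost `c`, which
  -- leaves `1 - ε - 3 * c = c`.
  set c := (1 - ε) / 4 with hc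
  have hc0 : 0 < c := by rw [hc]; linarith
  obtain ⟨C, hC, htail⟩ := exists_blockOutput_tail_le hp hσ h₁ h₂
  have hK : 0 < C / c := by positivity
  obtain ⟨κ, hκ, hcmp⟩ := exists_blockOutput_compare hp hσ hK hδ0 h₁ h₂
  refine ⟨c, hc0, ?_⟩
  have hα' : ∀ᶠ n in atTop, (S n).typeI P W < ENNReal.ofReal (ε + c) :=
    eventually_lt_of_limsup_lt (hα.trans_lt ((ENNReal.ofReal_lt_ofReal_iff (by linarith)).2
      (by linarith)))
  have hT := (tendsto_measure_not_le_of_lt hV (θ := D + δ) (by linarith)).eventually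
    (gt_mem_nhds (ENNReal.ofReal_pos.2 hc0))
  -- The cost estimate is used twice: with `κ` for the density comparison and with `1` for the tail
  -- bound.
  filter_upwards [hα', hT, eventually_noiselessOutput_cost_le hp hκ h₁ h₂ hΓ₁ hΓ₂,
    eventually_noiselessOutput_cost_le hp one_pos h₁ h₂ hΓ₁ hΓ₂, eventually_gt_atTop 0]
    with n hαn hTn hκn h1n hn
  set G : Set (Fin n → ℝ) := {y | ∑ i, |y i| ^ p ≤ C / c * n} with hG
  have hGm : MeasurableSet G :=
    measurableSet_le (Finset.measurable_sum _ fun i _ =>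
      (continuous_abs_rpow hp).measurable.comp (measurable_pi_apply i)) measurable_const
  set T : Set (Fin n → V) := {v | Measure.pi (fun _ : Fin n => marginalV P) {v} ≤
        ENNReal.ofReal (Real.exp (n * (D + δ))) *
          Measure.pi (fun _ : Fin n => marginalV Q) {v}} with hTdef
  have hTm : MeasurableSet T := T.toFinite.measurableSet
  set A : Set ((Fin n → ℝ) × (Fin n → V)) := {z | (S n).g z = 0} with hA
  have hAm : MeasurableSet A := (S n).measurable_g (measurableSet_singleton 0)
  set s := A ∩ {z | z.1 ∈ G} ∩ {z | z.2 ∈ T} with hs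
  have hsm : MeasurableSet s := (hAm.inter (measurable_fst hGm)).inter (measurable_snd hTm)
  have hcost : ∀ u₁ u₂, ∑ i, |(S n).f₁ u₁ i| ^ p ≤ Γ₁ n ∧ ∑ i, |(S n).f₂ u₂ i| ^ p ≤ Γ₂ n :=
    fun u₁ u₂ => ⟨(hS n hn).1 u₁, (hS n hn).2 u₂⟩
  have hGc : (S n).law P W {z | z.1 ∈ Gᶜ} ≤ ENNReal.ofReal c := by
    rw [(S n).law_apply _ _ (s := {z | z.1 ∈ Gᶜ}) (measurable_fst hGm.compl)]
    calc _ ≤ ∫⁻ _, ENNReal.ofReal c ∂(Measure.pi fun _ : Fin n => P) := by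
          refine lintegral_mono fun u => ?_
          obtain ⟨hu₁, hu₂⟩ := hcost (fun i => (u i).1) fun i => (u i).2.1
          have h := htail n _ _ hn (by simpa using h1n _ _ hu₁ hu₂) (C / c) hK
          rw [div_div_cancel₀ hC.ne'] at h
          refine (measure_mono fun y hy => ?_).trans h
          exact not_le.1 (show ¬ ∑ i, |y i| ^ p ≤ C / c * n from hy)
      _ = ENNReal.ofReal c := by simp
  have hTc : (S n).law P W {z | z.2 ∈ Tᶜ} ≤ ENNReal.ofReal c := by
    rw [Scheme.law_setOf_snd_mem hp hσ]
    exact hTn.le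
  have hlow : ENNReal.ofReal c ≤ (S n).law P W s := by
    have hcover : (Set.univ : Set ((Fin n → ℝ) × (Fin n → V))) ⊆
        {z | (S n).g z = 1} ∪ {z | z.1 ∈ Gᶜ} ∪ {z | z.2 ∈ Tᶜ} ∪ s := by
      intro z _
      have hg : (S n).g z = 0 ∨ (S n).g z = 1 := by omega
      by_cases h1 : z.1 ∈ G <;> by_cases h2 : z.2 ∈ T <;> rcases hg with hg | hg <;>
        simp [hs, hA, h1, h2, hg]
    have h1 : (1 : ℝ≥0∞) ≤ ENNReal.ofReal (ε + c + c + c) + (S n).law P W s := by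
      rw [← (S n).law_univ (h₁ := h₁) (h₂ := h₂) hp hσ P, ENNReal.ofReal_add (by linarith) hc0.le,
        ENNReal.ofReal_add (by linarith) hc0.le]
      refine (measure_mono hcover).trans ((measure_union_le _ _).trans ?_)
      gcongr
      refine (measure_union_le _ _).trans ?_
      gcongr
      refine (measure_union_le _ _).trans ?_
      gcongr
      exact hαn.le
    have h2 := tsub_le_iff_left.2 h1
    rw [← ENNReal.ofReal_one, ← ENNReal.ofReal_sub _ (by linarith)] at h2
    refine le_trans (ENNReal.ofReal_le_ofReal ?_) h2
    rw [hc]; linarith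
  have hsub : ∀ v, {y | (y, v) ∈ s} ⊆ G := fun v y hy => hy.1.2
  have hsm' : ∀ v, MeasurableSet {y | (y, v) ∈ s} := fun v => measurable_prodMk_right hsm
  have hup := (S n).law_le_mul_law P Q W (b := ENNReal.ofReal (Real.exp (n * δ)))
    (L := ENNReal.ofReal (Real.exp (n * (D + δ)))) ENNReal.ofReal_ne_top hsm
    (fun u₁ u₂ v => (hcmp n _ _ (hκn _ _ (hcost u₁ u₂).1 (hcost u₁ u₂).2) _ (hsub v) (hsm' v)).1)
    (fun u₁ u₂ v => (hcmp n _ _ (hκn _ _ (hcost u₁ u₂).1 (hcost u₁ u₂).2) _ (hsub v) (hsm' v)).2)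
    (fun z hz => hz.2)
  rw [← ENNReal.ofReal_mul (Real.exp_nonneg _), ← ENNReal.ofReal_mul (by positivity),
    ← Real.exp_add, ← Real.exp_add,
    show n * δ + n * (D + δ) + n * δ = n * θ by rw [hδ]; ring] at hup
  refine hlow.trans (hup.trans ?_)
  gcongr
  exact measure_mono fun z hz => hz.1.1

lemma le_integral_llr_of_isAchievable
    (P Q : Measure (U₁ × U₂ × V)) [IsProbabilityMeasure P] [IsProbabilityMeasure Q] (hPQ : P ≪ Q)
    (hp : 0 < p) (hσ : 0 < σ) {ε : ℝ} (hε₀ : 0 ≤ ε) (hε₁ : ε < 1) {Γ₁ Γ₂ : ℕ → ℝ}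
    (hΓ₁ : Tendsto (fun n : ℕ => Γ₁ n / n) atTop (𝓝 0))
    (hΓ₂ : Tendsto (fun n : ℕ => Γ₂ n / n) atTop (𝓝 0)) {θ : ℝ}
    (hθ : IsAchievable P Q (additiveMAC h₁ h₂ (genGaussian p σ)) (fun x : ℝ => |x| ^ p)
      (fun x : ℝ => |x| ^ p) Γ₁ Γ₂ ε θ) :
    θ ≤ ∫ v, llr (marginalV P) (marginalV Q) v ∂marginalV P := by
  by_contra! hlt
  obtain ⟨-, S, hS, hα, hβ⟩ := hθ
  -- With `D < θ₁ < θ₂ < θ`, the converse at `θ₁` and decay at rate `θ₂` give `c ≤ exp (n * (θ₁ -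
  -- θ₂))`, which fails for large `n`.
  obtain ⟨θ₁, hθ₁, hθ₁'⟩ := exists_between hlt
  obtain ⟨θ₂, hθ₂, hθ₂'⟩ := exists_between hθ₁'
  obtain ⟨c, hc, hev⟩ := exists_eventually_le_exp_mul_typeII P Q hPQ hp hσ hε₀ hε₁ hΓ₁ hΓ₂ S hS hα
    hθ₁
  have hev2 := eventually_lt_of_lt_liminf (lt_of_lt_of_le (EReal.coe_lt_coe_iff.2 hθ₂') hβ)
  have hlim : Tendsto (fun n : ℕ => Real.exp (n * (θ₁ - θ₂))) atTop (𝓝 0) :=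
    Real.tendsto_exp_atBot.comp
      (tendsto_natCast_atTop_atTop.atTop_mul_const_of_neg (sub_neg.2 hθ₂))
  obtain ⟨n, h1, h2, h3, hn⟩ := (hev.and (hev2.and ((hlim.eventually (gt_mem_nhds hc)).and
    (eventually_gt_atTop 0)))).exists
  have hn' : (0 : EReal) < (n : EReal) := by exact_mod_cast hn
  rw [EReal.lt_div_iff hn' (EReal.natCast_ne_top n)] at h2
  have h4 := EReal.lt_neg_of_lt_neg h2
  have h5 : (S n).typeII Q (additiveMAC h₁ h₂ (genGaussian p σ)) ≤
      ENNReal.ofReal (Real.exp (-(θ₂ * n))) := by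
    rw [← ENNReal.log_le_log_iff, ENNReal.log_ofReal_of_pos (Real.exp_pos _), Real.log_exp]
    refine h4.le.trans_eq ?_
    push_cast
    rfl
  have h6 := h1.trans (mul_le_mul_right h5 _)
  rw [← ENNReal.ofReal_mul (Real.exp_nonneg _), ← Real.exp_add,
    ENNReal.ofReal_le_ofReal_iff (Real.exp_nonneg _),
    show n * θ₁ + -(θ₂ * n) = n * (θ₁ - θ₂) by ring] at h6
  exact absurd h3 (not_lt.2 h6)

/-! ### Achievability -/

open Classical in
/-- The scheme with silent sensors that decides `0` iff the side information lies in `T`. -/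
noncomputable def silentScheme (U₁ U₂ : Type*) {V : Type*} [Finite V] [MeasurableSpace V]
    [MeasurableSingletonClass V] {n : ℕ} (T : Set (Fin n → V)) :
    Scheme U₁ U₂ V ℝ ℝ ℝ n where
  f₁ _ := 0
  f₂ _ := 0
  g z := if z.2 ∈ T then 0 else 1
  measurable_g := Measurable.ite (measurable_snd T.toFinite.measurableSet) measurable_const
    measurable_const

/-- Zero inputs cost nothing, so they fit every nonnegative budget. The type-I error of the
likelihood-ratio test tends to `0`, so it meets the limit for any `ε`. -/
lemma isAchievable_of_lt_integral_llr
    (P Q : Measure (U₁ × U₂ × V)) [IsProbabilityMeasure P] [IsProbabilityMeasure Q] (hPQ : P ≪ Q)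
    (hp : 0 < p) (hσ : 0 < σ) (ε : ℝ) {Γ₁ Γ₂ : ℕ → ℝ}
    (hΓ₁ : ∀ n, 1 ≤ n → 0 ≤ Γ₁ n) (hΓ₂ : ∀ n, 1 ≤ n → 0 ≤ Γ₂ n) {θ : ℝ} (hθ₀ : 0 < θ)
    (hθ : θ < ∫ v, llr (marginalV P) (marginalV Q) v ∂marginalV P) :
    IsAchievable P Q (additiveMAC h₁ h₂ (genGaussian p σ)) (fun x : ℝ => |x| ^ p)
      (fun x : ℝ => |x| ^ p) Γ₁ Γ₂ ε θ := by
  have := isProbabilityMeasure_marginalV P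
  have := isProbabilityMeasure_marginalV Q
  have hV : marginalV P ≪ marginalV Q := hPQ.map (by fun_prop)
  set T : (n : ℕ) → Set (Fin n → V) := fun n => {v | ENNReal.ofReal (Real.exp (n * θ)) *
    Measure.pi (fun _ : Fin n => marginalV Q) {v} ≤
      Measure.pi (fun _ : Fin n => marginalV P) {v}} with hT
  refine ⟨hθ₀, fun n => silentScheme U₁ U₂ (T n), fun n hn => ?_, ?_, ?_⟩
  · constructor <;> intro u <;> simp [silentScheme, Real.zero_rpow hp.ne', hΓ₁ n hn, hΓ₂ n hn]
  · have h : ∀ n, (silentScheme U₁ U₂ (T n)).typeI P (additiveMAC h₁ h₂ (genGaussian p σ)) =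
        Measure.pi (fun _ : Fin n => marginalV P) (T n)ᶜ := fun n => by
      rw [← Scheme.law_setOf_snd_mem (h₁ := h₁) (h₂ := h₂) hp hσ (silentScheme U₁ U₂ (T n))]
      unfold Scheme.typeI
      congr 1
      ext z
      simp [silentScheme]
    simp_rw [h]
    exact (tendsto_measure_not_le_of_gt hV hθ).limsup_eq.trans_le zero_le
  · have h : ∀ n, (silentScheme U₁ U₂ (T n)).typeII Q (additiveMAC h₁ h₂ (genGaussian p σ)) =
        Measure.pi (fun _ : Fin n => marginalV Q) (T n) := fun n => by
      rw [← Scheme.law_setOf_snd_mem (h₁ := h₁) (h₂ := h₂) hp hσ (silentScheme U₁ U₂ (T n))]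
      unfold Scheme.typeII
      congr 1
      ext z
      simp [silentScheme]
    simp_rw [h]
    refine le_liminf_of_le (by isBoundedDefault) ?_
    filter_upwards [eventually_gt_atTop 0] with n hn
    have hn' : (0 : EReal) < (n : EReal) := by exact_mod_cast hn
    rw [EReal.le_div_iff_mul_le hn' (EReal.natCast_ne_top n)]
    refine EReal.le_neg_of_le_neg ?_
    -- Summing the inequality that defines `T n` over its points bounds the left side by a
    -- `P_V`-probability.
    have hle : ENNReal.ofReal (Real.exp (n * θ)) *
        Measure.pi (fun _ : Fin n => marginalV Q) (T n) ≤ 1 := by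
      classical
      refine le_trans ?_ (prob_le_one (μ := Measure.pi fun _ : Fin n => marginalV P) (s := T n))
      rw [← Set.coe_toFinset (T n), ← sum_measure_singleton, ← sum_measure_singleton,
        Finset.mul_sum]
      exact Finset.sum_le_sum fun v hv => (Set.mem_toFinset.1 hv : v ∈ T n)
    have hle2 : Measure.pi (fun _ : Fin n => marginalV Q) (T n) ≤
        ENNReal.ofReal (Real.exp (-(θ * n))) := by
      rw [mul_comm, ← ENNReal.le_div_iff_mul_le (by simp [Real.exp_pos]) (by simp)] at hle
      rwa [Real.exp_neg, ENNReal.ofReal_inv_of_pos (Real.exp_pos _), mul_comm θ, ← one_div]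
    refine (ENNReal.log_le_log hle2).trans_eq ?_
    rw [ENNReal.log_ofReal_of_pos (Real.exp_pos _), Real.log_exp]
    push_cast
    rfl

end Law

end SublinearMAC

theorem theorem2 {U₁ U₂ V : Type*}
    [Fintype U₁] [MeasurableSpace U₁] [MeasurableSingletonClass U₁]
    [Fintype U₂] [MeasurableSpace U₂] [MeasurableSingletonClass U₂]
    [Fintype V] [MeasurableSpace V] [MeasurableSingletonClass V]
    (P Q : Measure (U₁ × U₂ × V)) [IsProbabilityMeasure P] [IsProbabilityMeasure Q]
    (hPQ : P ≪ Q)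
    (h₁ h₂ : ℝ) (hh₁ : h₁ ≠ 0) (hh₂ : h₂ ≠ 0)
    (p σ : ℝ) (hp : 0 < p) (hσ : 0 < σ)
    (ε : ℝ) (hε₀ : 0 ≤ ε) (hε₁ : ε < 1)
    (Γ₁ Γ₂ : ℕ → ℝ) (hΓ₁ : SublinearMAC.IsStringentBudget Γ₁)
    (hΓ₂ : SublinearMAC.IsStringentBudget Γ₂) :
    SublinearMAC.steinExponent P Q
        (SublinearMAC.additiveMAC h₁ h₂ (SublinearMAC.genGaussian p σ))
        (fun x : ℝ => |x| ^ p) (fun x : ℝ => |x| ^ p) Γ₁ Γ₂ ε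
      = InformationTheory.klDiv (SublinearMAC.marginalV P) (SublinearMAC.marginalV Q) := by
  have := SublinearMAC.isProbabilityMeasure_marginalV P
  have := SublinearMAC.isProbabilityMeasure_marginalV Q
  have hV : SublinearMAC.marginalV P ≪ SublinearMAC.marginalV Q := hPQ.map (by fun_prop)
  rw [SublinearMAC.klDiv_eq_ofReal_integral_llr hV]
  refine le_antisymm (iSup₂_le fun θ hθ => ENNReal.ofReal_le_ofReal
    (SublinearMAC.le_integral_llr_of_isAchievable P Q hPQ hp hσ hε₀ hε₁ hΓ₁.sublinear
      hΓ₂.sublinear hθ)) ?_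
  -- An intermediate `t'` is needed because achievable exponents are strictly positive while `t` may
  -- be `0`; zero divergence makes the claim vacuous.
  refine le_of_forall_lt fun t ht => ?_
  obtain ⟨t', htt', ht'⟩ := exists_between ht
  have htop : t' ≠ ∞ := ht'.ne_top
  have h0 : 0 < t'.toReal := ENNReal.toReal_pos (zero_le.trans_lt htt').ne' htop
  refine htt'.trans_le ?_
  rw [← ENNReal.ofReal_toReal htop] at ht' ⊢
  exact le_iSup₂ (f := fun (θ : ℝ) (_ : SublinearMAC.IsAchievable P Q _ _ _ Γ₁ Γ₂ ε θ) =>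
      ENNReal.ofReal θ) t'.toReal
    (SublinearMAC.isAchievable_of_lt_integral_llr P Q hPQ hp hσ ε hΓ₁.nonneg hΓ₂.nonneg h0
      (ENNReal.ofReal_lt_ofReal_iff'.1 ht').1)
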